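/- **Setting.** For a sequence $p=(p(k))_{k\in\mathbb N}$ write $\Delta p(k)=p(k+1)-2p(k)+p(k-1)$ for $k\ge 1$, and $F_p(k)=\sum_{j=0}^{k}p(j)$ with $F_p(-1)=0$. Let $p_0$ be a probability mass function on $\mathbb N$ with finite support $\{0,\dots,S\}$ that is convex, i.e. $\Delta p_0(k)\ge 0$ for all $k\ge 1$. Its interior knots are the integers $1\le k\le S$ with $\Delta p_0(k)>0$; denote them by $s_1<\dots<s_m$ and set $\mathcal K=\{s_1,\dots,s_m\}$, $s_0=0$ and $s_{m+1}=S+1$. Let $X_1,X_2,\dots$ be i.i.d. with probability mass function $p_0$, let $p_n(j)=\frac1n\sum_{i=1}^n\mathbb 1_{\{X_i=j\}}$ be the empirical probability mass function, and let $\widehat p_n$ be the convex least squares estimator, i.e. the unique minimizer of $\frac12\sum_{j\in\mathbb N}(p_n(j)-p(j))^2$ over all square-summable sequences $p$ with $\Delta p(k)\ge0$ for all $k\ge1$. Let $\mathbb U$ be a standard Brownian bridge on $[0,1]$ from $(0,0)$ to $(1,0)$, and let $\mathbb W(k)=\mathbb U(F_{p_0}(k))-\mathbb U(F_{p_0}(k-1))$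 for $k=0,\dots,S+1$. Let $\widehat g=(\widehat g(0),\dots,\widehat g(S+1))$ be the unique minimizer of $\frac12\sum_{k=0}^{S+1}(g(k)-\mathbb W(k))^2$ over the set of all $g\in\mathbb R^{S+2}$ that are convex on $\{s_j,\dots,s_{j+1}\}$ for every $j=0,\dots,m$, and let $\widehat{\mathbb G}(x)=\sum_{k=0}^{x}\widehat g(k)$. For an interior knot $s\in\mathcal K$, let $$\Phi^{\ge s}(g)=\frac12\sum_{k=s}^{S+1}(g(k)-\mathbb W(k))^2,$$ and let $\mathcal C^{\ge s}(\mathcal K)$ be the set of all $g=(g(s),\dots,g(S+1))\in\mathbb R^{S+2-s}$ that are convex on $\{s_j,\dots,s_{j+1}\}$ for all $j\in\{0,\dots,m\}$ with $s_j\ge s$. **Theorem.** Let $s\in\mathcal K$. 1. For every realization of $\mathbb U$, there exists a unique minimizer of $\Phi^{\ge s}$ over $\mathcal C^{\ge s}(\mathcal K)$. 2. For every realization of $\mathbb U$, this minimizer is equal to $(\widehat g(s),\dots,\widehat g(S+1))$ if, and only if, $$\widehat{\mathbb G}(s-1)=\mathbb U(F_{p_0}(s-1)).$$ 3. The random vector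 $\sqrt n\,(\widehat p_n(s)-p_0(s),\dots,\widehat p_n(S+1)-p_0(S+1))$ converges in distribution, as $n\to\infty$, to the minimizer of $\Phi^{\ge s}$ over $\mathcal C^{\ge s}(\mathcal K)$ if, and only if, $$F_{\widehat p_n}(s-1)=F_{p_n}(s-1)+o_p(n^{-1/2}).$$ -/

import Mathlib

open MeasureTheory ProbabilityTheory Filter Topology

noncomputable section

namespace ConvexLSE

/-- A minimizer of the criterion `Φ` over the set `C`. -/
def IsMinimizer {E : Type*} (Φ : E → ℝ) (C : Set E) (g : E) : Prop :=
  g ∈ C ∧ ∀ h ∈ C, Φ g ≤ Φ h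

/-- The minimizer of the criterion `Φ` over the set `C` (used below for squared distances to closed
convex sets in a Hilbert space, where it exists and is unique). -/
def argmin {E : Type*} [Nonempty E] (Φ : E → ℝ) (C : Set E) : E :=
  Classical.epsilon (IsMinimizer Φ C)

/-! ### Sequences, probability mass functions, knots -/

/-- Probability mass functions on `ℕ`. -/
def IsPmf (p : ℕ → ℝ) : Prop :=
  (∀ k, 0 ≤ p k) ∧ HasSum p 1

/-- The distribution function `F_p(k) = ∑_{j=0}^k p(j)`, with `F_p(-1) = 0`. -/
def cdf (p : ℕ → ℝ) (k : ℤ) : ℝ :=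
  ∑ j ∈ Finset.range (k + 1).toNat, p j

/-- The discrete Laplacian `Δp(k) = p(k+1) - 2p(k) + p(k-1)`, used only for `k ≥ 1`. -/
def lap (p : ℕ → ℝ) (k : ℕ) : ℝ :=
  p (k + 1) - 2 * p k + p (k - 1)

/-- Convexity of a sequence on `ℕ`. -/
def IsConvexSeq (p : ℕ → ℝ) : Prop :=
  ∀ k, 1 ≤ k → 0 ≤ lap p k

/-- The class `𝒞` of square summable convex sequences. -/
def convexL2 : Set (ℕ → ℝ) :=
  {p | Summable (fun k => p k ^ 2) ∧ IsConvexSeq p}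

/-- The set `𝒦` of interior knots of a convex pmf with support `{0, …, S}`. -/
def interiorKnots (p : ℕ → ℝ) (S : ℕ) : Set ℕ :=
  {k | 1 ≤ k ∧ k ≤ S ∧ 0 < lap p k}

/-! ### The least squares estimator -/

/-- The empirical pmf of `X₀, …, X_{n-1}`. -/
def empPmf {Ω : Type*} (X : ℕ → Ω → ℕ) (n : ℕ) (ω : Ω) (j : ℕ) : ℝ :=
  (1 / (n : ℝ)) * ∑ i ∈ Finset.range n, if X i ω = j then 1 else 0

/-- The convex least squares fit of `q`: the minimizer of `½ ∑_j (q(j) - p(j))²` over `p ∈ 𝒞`. -/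
def convexFit (q : ℕ → ℝ) : ℕ → ℝ :=
  argmin (fun p => (1 / 2) * ∑' j, (q j - p j) ^ 2) convexL2

/-- The convex least squares estimator based on `X₀, …, X_{n-1}`. -/
def lse {Ω : Type*} (X : ℕ → Ω → ℕ) (n : ℕ) (ω : Ω) : ℕ → ℝ :=
  convexFit (empPmf X n ω)

/-! ### The limit process -/

/-- `U` is a standard Brownian bridge on `[0,1]` from `(0,0)` to `(1,0)`. Only the values `U t` with
`t ∈ [0,1]` matter. -/
structure IsBrownianBridge {Ω : Type*} [MeasurableSpace Ω] (U : ℝ → Ω → ℝ) (P : Measure Ω) :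
    Prop where
  gaussian : IsGaussianProcess (fun t : Set.Icc (0 : ℝ) 1 => U t) P
  mean : ∀ t ∈ Set.Icc (0 : ℝ) 1, ∫ ω, U t ω ∂P = 0
  covariance : ∀ s ∈ Set.Icc (0 : ℝ) 1, ∀ t ∈ Set.Icc (0 : ℝ) 1,
    ProbabilityTheory.covariance (U s) (U t) P = min s t - s * t
  start : ∀ ω, U 0 ω = 0
  finish : ∀ ω, U 1 ω = 0
  continuous_paths : ∀ᵐ ω ∂P, ContinuousOn (fun t => U t ω) (Set.Icc 0 1)

/-- `𝕎(k) = 𝕌(F_p(k)) - 𝕌(F_p(k-1))`. -/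
def noise {Ω : Type*} (p : ℕ → ℝ) (U : ℝ → Ω → ℝ) (ω : Ω) (k : ℕ) : ℝ :=
  U (cdf p k) ω - U (cdf p (k - 1)) ω

/-- `g = (g(a), …, g(b))` is convex on `{u, …, v}`. -/
def ConvexBetween {a b : ℕ} (g : Finset.Icc a b → ℝ) (u v : ℕ) : Prop :=
  ∀ x y z : Finset.Icc a b, u ≤ (x : ℕ) → (y : ℕ) = x + 1 → (z : ℕ) = y + 1 → (z : ℕ) ≤ v →
    0 ≤ g z - 2 * g y + g x

/-- `u < v` are consecutive elements of `{s₀ = 0, s₁, …, s_m, s_{m+1} = S + 1}`, where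
`s₁ < … < s_m` are the interior knots of `p`. -/
def Consecutive (p : ℕ → ℝ) (S u v : ℕ) : Prop :=
  (u = 0 ∨ u ∈ interiorKnots p S) ∧ (v = S + 1 ∨ v ∈ interiorKnots p S) ∧ u < v ∧
    ∀ k ∈ interiorKnots p S, ¬ (u < k ∧ k < v)

/-- The cone `𝒞^{≥a}(𝒦)` of vectors `(g(a), …, g(S+1))` that are convex on `{s_j, …, s_{j+1}}` for
all `j ∈ {0, …, m}` with `s_j ≥ a`. For `a = 0` this is `𝒞(𝒦)`. -/
def knotCone (p : ℕ → ℝ) (S a : ℕ) : Set (Finset.Icc a (S + 1) → ℝ) :=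
  {g | ∀ u v, Consecutive p S u v → a ≤ u → ConvexBetween g u v}

/-- The criterion `Φ^{≥a}(g) = ½ ∑_{k=a}^{S+1} (g(k) - w(k))²`. For `a = 0` this is `Φ`. -/
def crit (S a : ℕ) (w : ℕ → ℝ) (g : Finset.Icc a (S + 1) → ℝ) : ℝ :=
  (1 / 2) * ∑ k, (g k - w k) ^ 2

/-- The minimizer of `Φ^{≥a}` over `𝒞^{≥a}(𝒦)`, for the realization `ω`. -/
def localMin {Ω : Type*} (p : ℕ → ℝ) (S a : ℕ) (U : ℝ → Ω → ℝ) (ω : Ω) :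
    Finset.Icc a (S + 1) → ℝ :=
  argmin (crit S a (noise p U ω)) (knotCone p S a)

/-- The minimizer `ĝ` of `Φ` over `𝒞(𝒦)`, for the realization `ω`. -/
def gHat {Ω : Type*} (p : ℕ → ℝ) (S : ℕ) (U : ℝ → Ω → ℝ) (ω : Ω) :
    Finset.Icc 0 (S + 1) → ℝ :=
  localMin p S 0 U ω

/-- `Ĝ(x) = ∑_{k=0}^x ĝ(k)`. -/
def GHat {Ω : Type*} (p : ℕ → ℝ) (S : ℕ) (U : ℝ → Ω → ℝ) (ω : Ω) (x : ℕ) : ℝ :=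
  ∑ k : Finset.Icc 0 (S + 1), if (k : ℕ) ≤ x then gHat p S U ω k else 0

/-- The restriction `(g(a), …, g(b))` of `(g(0), …, g(b))`. -/
def tail {b : ℕ} (a : ℕ) (g : Finset.Icc 0 b → ℝ) : Finset.Icc a b → ℝ :=
  fun k => g ⟨k, Finset.Icc_subset_Icc_left (Nat.zero_le a) k.2⟩

end ConvexLSE

end

/-! Interior knots impose no convexity constraint, so `knotCone p S 0` is a closed convex cone, and
its projection g of w is characterised by residuals w - g with nonpositive inner product with the
cone and zero inner product with g. Constants of both signs lie in the cone, hence the residuals sum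
to zero. The indicator of {k ≥ s} jumps upwards at a knot and also lies in the cone, hence the
residuals over {s, …, S+1} have a nonpositive sum, `tailGap`.

The tail of the global projection is the local projection exactly when `tailGap` vanishes
(`proj_eq_tail_iff`). Necessity holds because local residuals also sum to zero. For sufficiency, a
zero tail sum allows any constant to be added to a local test vector, which can then be lifted and
glued to any global one at s, so the global optimality conditions split at s. Since 𝕎 telescopes,
`tailGap` is also Ĝ(s-1) - 𝕌(F(s-1)), which gives the second claim.

For the third claim, near p₀ the estimator equals p₀ plus the projection of p_n - p₀
(`exists_convexFit_eq`): strict convexity at the knots absorbs small perturbations. The projection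
is continuous and positively homogeneous, so the multinomial central limit theorem and continuous
mapping give the tail of ĝ as the limit of the rescaled estimator, and `tailGap` of 𝕎 as the limit
of the rescaled difference of distribution functions. That difference is negligible if and only if
`tailGap` is almost surely zero. If the local minimizer is the limit in law, it has the same law as
the tail of ĝ; comparing expected coordinate sums gives `tailGap` mean zero, and its sign makes it
vanish almost surely (`ae_tailGap_eq_zero`). -/

namespace ConvexLSE

/-! ### Projections onto closed convex cones in coordinate space -/

section Projection

variable {ι : Type*} [Fintype ι]

/-- `C` is a closed convex cone. -/
structure IsClosedConvexCone (C : Set (ι → ℝ)) : Prop where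
  isClosed : IsClosed C
  zero_mem : 0 ∈ C
  add_mem : ∀ {g h : ι → ℝ}, g ∈ C → h ∈ C → g + h ∈ C
  smul_mem : ∀ {c : ℝ} {g : ι → ℝ}, 0 ≤ c → g ∈ C → c • g ∈ C

/-- Half the squared Euclidean distance. -/
noncomputable def sqLoss (w g : ι → ℝ) : ℝ :=
  (1 / 2) * ∑ k, (g k - w k) ^ 2

/-- The projection of `w` onto `C`. -/
noncomputable def proj (C : Set (ι → ℝ)) (w : ι → ℝ) : ι → ℝ :=
  argmin (sqLoss w) C

/-- Dividing by t and letting t tend to 0 gives the claim; for positive a, the value t = a / (2(|b|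
+ a)) is already a contradiction. -/
lemma nonpos_of_forall_mul_le_sq {a b : ℝ} (h : ∀ t : ℝ, 0 < t → t ≤ 1 → t * a ≤ t ^ 2 * b) :
    a ≤ 0 := by
  by_contra! ha
  have hb : 0 < |b| + a := by positivity
  have h1 : a / (2 * (|b| + a)) ≤ 1 := by
    rw [div_le_one (by positivity)]
    linarith [abs_nonneg b]
  have h2 := h (a / (2 * (|b| + a))) (by positivity) h1
  have h3 : 0 < a / (2 * (|b| + a)) := by positivity
  have h4 : a ≤ a / (2 * (|b| + a)) * b := by
    refine le_of_mul_le_mul_left ?_ h3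
    linarith
  have h5 : a / (2 * (|b| + a)) * b ≤ a / 2 := by
    calc a / (2 * (|b| + a)) * b ≤ a / (2 * (|b| + a)) * (|b| + a) := by
          gcongr
          linarith [le_abs_self b]
      _ = a / 2 := by field_simp
  linarith

lemma sqLoss_add (w g d : ι → ℝ) :
    sqLoss w (g + d) = sqLoss w g - ∑ k, (w k - g k) * d k + (1 / 2) * ∑ k, d k ^ 2 := by
  simp only [sqLoss, Finset.mul_sum, ← Finset.sum_sub_distrib, ← Finset.sum_add_distrib]
  refine Finset.sum_congr rfl fun k _ => ?_
  simp only [Pi.add_apply]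
  ring

lemma IsMinimizer.sum_mul_nonpos {C : Set (ι → ℝ)} {w g d : ι → ℝ}
    (hg : IsMinimizer (sqLoss w) C g) (hd : ∀ t : ℝ, 0 < t → t ≤ 1 → g + t • d ∈ C) :
    ∑ k, (w k - g k) * d k ≤ 0 := by
  refine nonpos_of_forall_mul_le_sq (b := (1 / 2) * ∑ k, d k ^ 2) fun t ht ht1 => ?_
  have h := hg.2 _ (hd t ht ht1)
  rw [sqLoss_add] at h
  have e1 : ∑ k, (w k - g k) * (t • d) k = t * ∑ k, (w k - g k) * d k := by
    rw [Finset.mul_sum]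
    exact Finset.sum_congr rfl fun k _ => by simp only [Pi.smul_apply, smul_eq_mul]; ring
  have e2 : ∑ k, (t • d) k ^ 2 = t ^ 2 * ∑ k, d k ^ 2 := by
    rw [Finset.mul_sum]
    exact Finset.sum_congr rfl fun k _ => by simp only [Pi.smul_apply, smul_eq_mul]; ring
  rw [e1, e2] at h
  linarith

/-- First-order conditions are tested in the directions h, which the cone allows at every g, and -g,
which stays in the cone since (1 - t)g belongs to it for t ≤ 1. Conversely they suffice because the
loss is quadratic. -/
lemma isMinimizer_sqLoss_iff {C : Set (ι → ℝ)} (hC : IsClosedConvexCone C) {w g : ι → ℝ} :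
    IsMinimizer (sqLoss w) C g ↔
      g ∈ C ∧ (∀ h ∈ C, ∑ k, (w k - g k) * h k ≤ 0) ∧ ∑ k, (w k - g k) * g k = 0 := by
  constructor
  · intro hg
    have h1 : ∀ h ∈ C, ∑ k, (w k - g k) * h k ≤ 0 := fun h hh =>
      hg.sum_mul_nonpos fun t ht _ => hC.add_mem hg.1 (hC.smul_mem ht.le hh)
    refine ⟨hg.1, h1, le_antisymm (h1 g hg.1) ?_⟩
    have h2 := hg.sum_mul_nonpos (d := -g) fun t _ ht1 => by
      have : g + t • -g = (1 - t) • g := by module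
      rw [this]
      exact hC.smul_mem (by linarith) hg.1
    simpa using h2
  · rintro ⟨hg, h1, h2⟩
    refine ⟨hg, fun h hh => ?_⟩
    have e : h = g + (h - g) := by abel
    rw [e, sqLoss_add]
    have h3 : ∑ k, (w k - g k) * (h - g) k = ∑ k, (w k - g k) * h k - ∑ k, (w k - g k) * g k := by
      rw [← Finset.sum_sub_distrib]
      exact Finset.sum_congr rfl fun k _ => by simp only [Pi.sub_apply]; ring
    have h4 : 0 ≤ ∑ k, (h - g) k ^ 2 := Finset.sum_nonneg fun k _ => sq_nonneg _
    linarith [h1 h hh]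

lemma exists_isMinimizer_sqLoss {C : Set (ι → ℝ)} (hC : IsClosedConvexCone C) (w : ι → ℝ) :
    ∃ g, IsMinimizer (sqLoss w) C g := by
  -- The default metric on functions is the sup metric, so the nearest point is taken in
  -- `EuclideanSpace`.
  have hcl : IsClosed ((WithLp.ofLp : EuclideanSpace ℝ ι → ι → ℝ) ⁻¹' C) :=
    hC.isClosed.preimage (PiLp.continuous_ofLp 2 _)
  obtain ⟨y, hy, hd⟩ := hcl.exists_infDist_eq_dist ⟨0, hC.zero_mem⟩ (WithLp.toLp 2 w)
  have key : ∀ g : ι → ℝ, sqLoss w g = (1 / 2) * dist (WithLp.toLp 2 w) (WithLp.toLp 2 g) ^ 2 := by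
    intro g
    rw [EuclideanSpace.dist_eq, Real.sq_sqrt (Finset.sum_nonneg fun k _ => sq_nonneg _), sqLoss]
    congr 1
    refine Finset.sum_congr rfl fun k _ => ?_
    rw [Real.dist_eq, sq_abs]
    ring
  refine ⟨y.ofLp, hy, fun h hh => ?_⟩
  rw [key, key]
  gcongr
  calc dist (WithLp.toLp 2 w) (WithLp.toLp 2 y.ofLp) = _ := hd.symm
    _ ≤ _ := Metric.infDist_le_dist_of_mem (s := (WithLp.ofLp : EuclideanSpace ℝ ι → ι → ℝ) ⁻¹' C) hh

lemma isMinimizer_proj {C : Set (ι → ℝ)} (hC : IsClosedConvexCone C) (w : ι → ℝ) :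
    IsMinimizer (sqLoss w) C (proj C w) :=
  Classical.epsilon_spec (exists_isMinimizer_sqLoss hC w)

/-- Projections are nonexpansive: in the expansion of ‖w - w'‖² the cross terms are nonnegative by
the optimality conditions of each minimizer tested against the other. Uniqueness and continuity both
follow from this. -/
lemma sum_sq_sub_le_of_isMinimizer {C : Set (ι → ℝ)} (hC : IsClosedConvexCone C)
    {w w' g g' : ι → ℝ} (hg : IsMinimizer (sqLoss w) C g) (hg' : IsMinimizer (sqLoss w') C g') :
    ∑ k, (g k - g' k) ^ 2 ≤ ∑ k, (w k - w' k) ^ 2 := by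
  rw [isMinimizer_sqLoss_iff hC] at hg hg'
  have h1 := hg.2.1 g' hg'.1
  have h2 := hg'.2.1 g hg.1
  have h3 := hg.2.2
  have h4 := hg'.2.2
  have h5 : 0 ≤ ∑ k, ((w k - w' k) - (g k - g' k)) ^ 2 := Finset.sum_nonneg fun k _ => sq_nonneg _
  have e : ∑ k, (w k - w' k) ^ 2 = ∑ k, ((w k - w' k) - (g k - g' k)) ^ 2
      + ∑ k, (g k - g' k) ^ 2 + 2 * (∑ k, (w k - g k) * g k - ∑ k, (w k - g k) * g' k
        - ∑ k, (w' k - g' k) * g k + ∑ k, (w' k - g' k) * g' k) := by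
    simp only [Finset.mul_sum, ← Finset.sum_sub_distrib, ← Finset.sum_add_distrib]
    exact Finset.sum_congr rfl fun k _ => by ring
  linarith

lemma IsMinimizer.eq {C : Set (ι → ℝ)} (hC : IsClosedConvexCone C)
    {w g g' : ι → ℝ} (hg : IsMinimizer (sqLoss w) C g) (hg' : IsMinimizer (sqLoss w) C g') :
    g = g' := by
  have h := sum_sq_sub_le_of_isMinimizer hC hg hg'
  simp only [sub_self, ne_eq, OfNat.ofNat_ne_zero, not_false_eq_true, zero_pow,
    Finset.sum_const_zero] at h
  have h0 := (Finset.sum_eq_zero_iff_of_nonneg fun k _ => sq_nonneg (g k - g' k)).1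
    (le_antisymm h (Finset.sum_nonneg fun k _ => sq_nonneg _))
  funext k
  have := h0 k (Finset.mem_univ k)
  rw [sq_eq_zero_iff] at this
  linarith

lemma proj_eq_iff {C : Set (ι → ℝ)} (hC : IsClosedConvexCone C) {w g : ι → ℝ} :
    proj C w = g ↔
      g ∈ C ∧ (∀ h ∈ C, ∑ k, (w k - g k) * h k ≤ 0) ∧ ∑ k, (w k - g k) * g k = 0 := by
  rw [← isMinimizer_sqLoss_iff hC]
  exact ⟨fun h => h ▸ isMinimizer_proj hC w, fun h => (isMinimizer_proj hC w).eq hC h⟩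

lemma proj_spec {C : Set (ι → ℝ)} (hC : IsClosedConvexCone C) (w : ι → ℝ) :
    proj C w ∈ C ∧ (∀ h ∈ C, ∑ k, (w k - proj C w k) * h k ≤ 0) ∧
      ∑ k, (w k - proj C w k) * proj C w k = 0 :=
  (proj_eq_iff hC).1 rfl

lemma proj_zero {C : Set (ι → ℝ)} (hC : IsClosedConvexCone C) : proj C 0 = 0 :=
  (proj_eq_iff hC).2 ⟨hC.zero_mem, by simp, by simp⟩

/-- Lets the factor √n pass through the projection. -/
lemma proj_smul {C : Set (ι → ℝ)} (hC : IsClosedConvexCone C) {c : ℝ} (hc : 0 ≤ c) (w : ι → ℝ) :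
    proj C (c • w) = c • proj C w := by
  obtain ⟨h1, h2, h3⟩ := proj_spec hC w
  have e : ∀ h : ι → ℝ, ∑ k, ((c • w) k - (c • proj C w) k) * h k
      = c * ∑ k, (w k - proj C w k) * h k := fun h => by
    rw [Finset.mul_sum]
    exact Finset.sum_congr rfl fun k _ => by simp only [Pi.smul_apply, smul_eq_mul]; ring
  refine (proj_eq_iff hC).2 ⟨hC.smul_mem hc h1, fun h hh => ?_, ?_⟩
  · rw [e]
    exact mul_nonpos_of_nonneg_of_nonpos hc (h2 h hh)
  · have : ∑ k, (w k - proj C w k) * (c • proj C w) k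
        = c * ∑ k, (w k - proj C w k) * proj C w k := by
      rw [Finset.mul_sum]
      exact Finset.sum_congr rfl fun k _ => by simp only [Pi.smul_apply, smul_eq_mul]; ring
    rw [e, this, h3, mul_zero, mul_zero]

lemma continuous_proj {C : Set (ι → ℝ)} (hC : IsClosedConvexCone C) : Continuous (proj C) := by
  rw [continuous_pi_iff]
  intro k
  rw [continuous_iff_continuousAt]
  intro w
  have hlim : Tendsto (fun v : ι → ℝ => √(∑ k, (v k - w k) ^ 2)) (𝓝 w) (𝓝 0) := by
    have : Continuous (fun v : ι → ℝ => √(∑ k, (v k - w k) ^ 2)) := by fun_prop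
    simpa using this.tendsto w
  refine tendsto_iff_dist_tendsto_zero.2 (squeeze_zero (fun _ => dist_nonneg) (fun v => ?_) hlim)
  rw [Real.dist_eq]
  refine Real.abs_le_sqrt (le_trans ?_
    (sum_sq_sub_le_of_isMinimizer hC (isMinimizer_proj hC v) (isMinimizer_proj hC w)))
  exact Finset.single_le_sum (f := fun k => (proj C v k - proj C w k) ^ 2)
    (fun k _ => sq_nonneg _) (Finset.mem_univ k)

end Projection

/-! ### Cones of vectors that are convex between knots -/

section KnotCone

variable {p : ℕ → ℝ} {S a s : ℕ}

/-- The extension by zero of a vector indexed by `{a, …, b}` to a sequence. -/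
noncomputable def toSeq {a b : ℕ} (g : Finset.Icc a b → ℝ) (k : ℕ) : ℝ :=
  if h : k ∈ Finset.Icc a b then g ⟨k, h⟩ else 0

@[simp]
lemma toSeq_coe {a b : ℕ} (g : Finset.Icc a b → ℝ) (k : Finset.Icc a b) : toSeq g k = g k := by
  simp [toSeq]

lemma toSeq_of_notMem {a b k : ℕ} (g : Finset.Icc a b → ℝ) (h : k ∉ Finset.Icc a b) :
    toSeq g k = 0 :=
  dif_neg h

lemma toSeq_eq_of_mem {a b k : ℕ} (f : ℕ → ℝ) (h : k ∈ Finset.Icc a b) :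
    toSeq (fun j : Finset.Icc a b => f j) k = f k :=
  dif_pos h

lemma tail_eq_toSeq {a b : ℕ} (g : Finset.Icc 0 b → ℝ) :
    tail a g = fun k : Finset.Icc a b => toSeq g k := by
  funext k
  exact (toSeq_coe g ⟨k, Finset.Icc_subset_Icc_left (Nat.zero_le a) k.2⟩).symm

/-- `f` is convex at all points of `{a + 1, …, S}` that are not interior knots. -/
def ConvexOffKnots (p : ℕ → ℝ) (S a : ℕ) (f : ℕ → ℝ) : Prop :=
  ∀ k, a < k → k ≤ S → k ∉ interiorKnots p S → 0 ≤ lap f k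

lemma isClosedConvexCone_knotCone (p : ℕ → ℝ) (S a : ℕ) :
    IsClosedConvexCone (knotCone p S a) where
  isClosed := by
    simp only [knotCone, ConvexBetween, Set.ofPred_forall]
    repeat' first
      | exact isClosed_le continuous_const (by fun_prop)
      | refine isClosed_iInter fun _ => ?_
  zero_mem := fun u v _ _ x y z _ _ _ _ => by simp
  add_mem := fun hg hh u v huv hu x y z h1 h2 h3 h4 => by
    have e1 := hg u v huv hu x y z h1 h2 h3 h4
    have e2 := hh u v huv hu x y z h1 h2 h3 h4
    simp only [Pi.add_apply]
    linarith
  smul_mem := fun {c g} hc hg u v huv hu x y z h1 h2 h3 h4 => by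
    have e1 := mul_nonneg hc (hg u v huv hu x y z h1 h2 h3 h4)
    simp only [Pi.smul_apply, smul_eq_mul]
    linarith

/-- A non-knot lies strictly between two consecutive knots. -/
lemma exists_consecutive (ha : a = 0 ∨ a ∈ interiorKnots p S) {k : ℕ} (hak : a < k) (hkS : k ≤ S)
    (hk : k ∉ interiorKnots p S) : ∃ u v, Consecutive p S u v ∧ a ≤ u ∧ u < k ∧ k < v := by
  classical
  let A : Finset ℕ := {j ∈ Finset.range k | j = 0 ∨ j ∈ interiorKnots p S}
  have hA : A.Nonempty := ⟨a, by simp [A, hak, ha]⟩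
  have hB : ∃ v, k < v ∧ (v = S + 1 ∨ v ∈ interiorKnots p S) := ⟨S + 1, by omega, Or.inl rfl⟩
  have hu : A.max' hA ∈ A := A.max'_mem hA
  simp only [A, Finset.mem_filter, Finset.mem_range] at hu
  obtain ⟨hv1, hv2⟩ := Nat.find_spec hB
  refine ⟨A.max' hA, Nat.find hB, ⟨hu.2, hv2, hu.1.trans hv1, ?_⟩,
    A.le_max' a (by simp [A, hak, ha]), hu.1, hv1⟩
  rintro j hj ⟨h1, h2⟩
  rcases lt_trichotomy j k with h | h | h
  · exact absurd (A.le_max' j (by simp [A, h, hj])) (not_le.2 h1)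
  · exact hk (h ▸ hj)
  · exact Nat.find_min hB h2 ⟨h, Or.inr hj⟩

/-- The interior points of the pieces are precisely the non-knots. The condition on a is needed so
that each non-knot beyond a lies in a piece starting at or after a. -/
lemma mem_knotCone_iff (ha : a = 0 ∨ a ∈ interiorKnots p S) (f : ℕ → ℝ) :
    (fun k : Finset.Icc a (S + 1) => f k) ∈ knotCone p S a ↔ ConvexOffKnots p S a f := by
  constructor
  · intro h k hak hkS hk
    obtain ⟨u, v, huv, hau, huk, hkv⟩ := exists_consecutive ha hak hkS hk
    have := h u v huv hau ⟨k - 1, by simp; omega⟩ ⟨k, by simp; omega⟩ ⟨k + 1, by simp; omega⟩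
      (by simp; omega) (by simp; omega) (by simp) (by simp; omega)
    simpa [lap] using this
  · intro h u v huv hau x y z hux hxy hyz hzv
    have hx := Finset.mem_Icc.1 x.2
    have hz := Finset.mem_Icc.1 z.2
    have := h y (by omega) (by omega) fun hy => huv.2.2.2 y hy ⟨by omega, by omega⟩
    have e : (y : ℕ) - 1 = x := by omega
    rw [lap, e, ← hyz] at this
    exact this

lemma mem_knotCone_iff_toSeq (ha : a = 0 ∨ a ∈ interiorKnots p S)
    (g : Finset.Icc a (S + 1) → ℝ) : g ∈ knotCone p S a ↔ ConvexOffKnots p S a (toSeq g) := by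
  rw [← mem_knotCone_iff ha]
  simp

/-- The projection of `(w(a), …, w(S+1))` onto `𝒞^{≥a}(𝒦)`, extended by zero to a sequence. -/
noncomputable def fit (p : ℕ → ℝ) (S a : ℕ) (w : ℕ → ℝ) : ℕ → ℝ :=
  toSeq (proj (knotCone p S a) fun k => w k)

lemma proj_knotCone_eq_iff (ha : a = 0 ∨ a ∈ interiorKnots p S) (w f : ℕ → ℝ) :
    proj (knotCone p S a) (fun k => w k) = (fun k : Finset.Icc a (S + 1) => f k) ↔
      ConvexOffKnots p S a f ∧
      (∀ h, ConvexOffKnots p S a h → ∑ k ∈ Finset.Icc a (S + 1), (w k - f k) * h k ≤ 0) ∧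
      ∑ k ∈ Finset.Icc a (S + 1), (w k - f k) * f k = 0 := by
  rw [proj_eq_iff (isClosedConvexCone_knotCone p S a), mem_knotCone_iff ha,
    Finset.sum_coe_sort (Finset.Icc a (S + 1)) fun k => (w k - f k) * f k]
  refine and_congr_right fun _ => and_congr_left fun _ => ⟨fun H h hh => ?_, fun H h hh => ?_⟩
  · rw [← Finset.sum_coe_sort (Finset.Icc a (S + 1)) fun k => (w k - f k) * h k]
    exact H _ ((mem_knotCone_iff ha h).2 hh)
  · have := H _ ((mem_knotCone_iff_toSeq ha h).1 hh)
    rw [← Finset.sum_coe_sort (Finset.Icc a (S + 1)) fun k => (w k - f k) * toSeq h k] at this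
    simpa using this

lemma fit_spec (ha : a = 0 ∨ a ∈ interiorKnots p S) (w : ℕ → ℝ) :
    ConvexOffKnots p S a (fit p S a w) ∧
      (∀ h, ConvexOffKnots p S a h →
        ∑ k ∈ Finset.Icc a (S + 1), (w k - fit p S a w k) * h k ≤ 0) ∧
      ∑ k ∈ Finset.Icc a (S + 1), (w k - fit p S a w k) * fit p S a w k = 0 :=
  (proj_knotCone_eq_iff ha w _).1 (by simp [fit])

lemma convexOffKnots_const (c : ℝ) : ConvexOffKnots p S a fun _ => c :=
  fun k _ _ _ => by simp only [lap]; linarith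

lemma sum_sub_fit (ha : a = 0 ∨ a ∈ interiorKnots p S) (w : ℕ → ℝ) :
    ∑ k ∈ Finset.Icc a (S + 1), (w k - fit p S a w k) = 0 := by
  have h1 := (fit_spec ha w).2.1 _ (convexOffKnots_const 1)
  have h2 := (fit_spec ha w).2.1 _ (convexOffKnots_const (-1))
  simp only [mul_one, mul_neg, Finset.sum_neg_distrib] at h1 h2
  linarith

/-- A sequence that is convex off the knots beyond a knot `s` remains convex off the knots when it
is replaced by another such sequence before `s` that lies below it at `s`. -/
lemma ConvexOffKnots.glue (hs : s ∈ interiorKnots p S) {f h : ℕ → ℝ}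
    (hf : ConvexOffKnots p S 0 f) (hh : ConvexOffKnots p S s h) (hfh : f s ≤ h s) :
    ConvexOffKnots p S 0 fun k => if s ≤ k then h k else f k := by
  intro k hk hkS hkn
  rcases lt_trichotomy k s with hlt | heq | hgt
  · have h1 := hf k hk hkS hkn
    simp only [lap, if_neg (not_le.2 hlt), if_neg (show ¬ s ≤ k - 1 by omega)] at h1 ⊢
    split_ifs with h
    -- At s - 1 the only altered value is the one at s, which is raised, so the second difference
    -- can only grow.
    · have : k + 1 = s := by omega
      rw [this] at h1 ⊢
      linarith
    · exact h1
  · exact absurd (heq ▸ hs) hkn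
  · have h1 := hh k hgt hkS hkn
    simp only [lap, if_pos hgt.le, if_pos (show s ≤ k - 1 by omega),
      if_pos (show s ≤ k + 1 by omega)] at h1 ⊢
    exact h1

lemma sum_Icc_eq_range_add (hsS : s ≤ S) (f : ℕ → ℝ) :
    ∑ k ∈ Finset.Icc 0 (S + 1), f k
      = ∑ k ∈ Finset.range s, f k + ∑ k ∈ Finset.Icc s (S + 1), f k := by
  rw [Finset.range_eq_Ico, ← Finset.sum_union]
  · refine Finset.sum_congr ?_ fun _ _ => rfl
    ext k
    simp only [Finset.mem_Icc, Finset.mem_union, Finset.mem_Ico]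
    omega
  · rw [Finset.disjoint_left]
    intro k h1 h2
    simp only [Finset.mem_Icc, Finset.mem_Ico] at h1 h2
    omega

/-- The test vector is the indicator of {k ≥ s}, admissible because s is a knot. -/
lemma sum_tail_sub_fit_nonpos (hs : s ∈ interiorKnots p S) (w : ℕ → ℝ) :
    ∑ k ∈ Finset.Icc s (S + 1), (w k - fit p S 0 w k) ≤ 0 := by
  have h := (fit_spec (Or.inl rfl) w).2.1 _
    (ConvexOffKnots.glue hs (convexOffKnots_const 0) (convexOffKnots_const 1) zero_le_one)
  rw [sum_Icc_eq_range_add hs.2.1] at h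
  have e1 : ∑ k ∈ Finset.range s, (w k - fit p S 0 w k) * (if s ≤ k then 1 else 0) = 0 :=
    Finset.sum_eq_zero fun k hk => by
      rw [if_neg (not_le.2 (Finset.mem_range.1 hk)), mul_zero]
  have e2 : ∑ k ∈ Finset.Icc s (S + 1), (w k - fit p S 0 w k) * (if s ≤ k then 1 else 0)
      = ∑ k ∈ Finset.Icc s (S + 1), (w k - fit p S 0 w k) :=
    Finset.sum_congr rfl fun k hk => by rw [if_pos (Finset.mem_Icc.1 hk).1, mul_one]
  rw [e1, e2, zero_add] at h
  exact h

lemma sum_range_sub_fit (hs : s ∈ interiorKnots p S) (w : ℕ → ℝ) :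
    ∑ k ∈ Finset.range s, (w k - fit p S 0 w k)
      = -∑ k ∈ Finset.Icc s (S + 1), (w k - fit p S 0 w k) := by
  have h := sum_sub_fit (p := p) (S := S) (Or.inl rfl) w
  rw [sum_Icc_eq_range_add hs.2.1] at h
  linarith

/-- The local projection beyond a knot `s` is the restriction of the global one if and only if the
cumulative sums of the global projection and of the data agree at `s - 1`. -/
lemma proj_eq_tail_iff (hs : s ∈ interiorKnots p S) (w : ℕ → ℝ) :
    proj (knotCone p S s) (fun k => w k) = tail s (proj (knotCone p S 0) fun k => w k) ↔
      ∑ k ∈ Finset.Icc s (S + 1), (w k - fit p S 0 w k) = 0 := by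
  rw [tail_eq_toSeq]
  constructor
  · intro h
    rw [← sum_sub_fit (Or.inr hs) w]
    refine Finset.sum_congr rfl fun k hk => ?_
    rw [fit, fit, h, toSeq_eq_of_mem _ hk]
  · intro h0
    obtain ⟨g1, g2, g3⟩ := fit_spec (p := p) (S := S) (Or.inl rfl) w
    set r := fit p S 0 w with hr
    refine (proj_knotCone_eq_iff (Or.inr hs) w _).2 ?_
    change ConvexOffKnots p S s r ∧ (∀ h, ConvexOffKnots p S s h →
      ∑ k ∈ Finset.Icc s (S + 1), (w k - r k) * h k ≤ 0) ∧
      ∑ k ∈ Finset.Icc s (S + 1), (w k - r k) * r k = 0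
    -- This is where the zero tail sum enters: a local test vector may be raised above any f at s
    -- without changing its inner product with the residuals.
    have hshift : ∀ (h : ℕ → ℝ) (c : ℝ), ∑ k ∈ Finset.Icc s (S + 1), (w k - r k) * (h k + c)
        = ∑ k ∈ Finset.Icc s (S + 1), (w k - r k) * h k := by
      intro h c
      simp only [mul_add, Finset.sum_add_distrib, ← Finset.sum_mul, h0, zero_mul, add_zero]
    have hglue : ∀ f h : ℕ → ℝ, ConvexOffKnots p S 0 f → ConvexOffKnots p S s h →
        ∑ k ∈ Finset.range s, (w k - r k) * f k
          + ∑ k ∈ Finset.Icc s (S + 1), (w k - r k) * h k ≤ 0 := by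
      intro f h hf hh
      have hc : ConvexOffKnots p S s fun k => h k + |f s - h s| := fun k h1 h2 h3 => by
        have := hh k h1 h2 h3
        simp only [lap] at this ⊢
        linarith
      have := g2 _ (ConvexOffKnots.glue hs hf hc (by linarith [le_abs_self (f s - h s)]))
      rw [sum_Icc_eq_range_add hs.2.1] at this
      rw [← hshift h |f s - h s|]
      refine le_trans (le_of_eq ?_) this
      congr 1
      · refine Finset.sum_congr rfl fun k hk => ?_
        rw [if_neg (not_le.2 (Finset.mem_range.1 hk))]
      · refine Finset.sum_congr rfl fun k hk => ?_
        rw [if_pos (Finset.mem_Icc.1 hk).1]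
    have hr' : ConvexOffKnots p S s r := fun k h1 h2 h3 => g1 k (by omega) h2 h3
    have htail : ∀ h, ConvexOffKnots p S s h →
        ∑ k ∈ Finset.Icc s (S + 1), (w k - r k) * h k ≤ 0 := fun h hh => by
      simpa using hglue _ h (convexOffKnots_const 0) hh
    -- Head and tail inner products with r add up to zero; gluing r to the zero tail makes the head
    -- part nonpositive, so the tail part is nonnegative.
    refine ⟨hr', htail, le_antisymm (htail r hr') ?_⟩
    have h2 := hglue r _ g1 (convexOffKnots_const 0)
    simp only [mul_zero, Finset.sum_const_zero, add_zero] at h2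
    rw [sum_Icc_eq_range_add hs.2.1] at g3
    linarith

end KnotCone

/-! ### The convex least squares fit near a finitely supported convex sequence -/

section Fit

variable {p q : ℕ → ℝ} {S : ℕ}

lemma eq_zero_of_forall_tsum_le {d : ℕ → ℝ} (hd : Summable fun k => d k ^ 2)
    (h : ∑' k, d k ^ 2 ≤ 0) : d = 0 := by
  have h0 := (hasSum_zero_iff_of_nonneg fun k => sq_nonneg (d k)).1
    (le_antisymm h (tsum_nonneg fun k => sq_nonneg (d k)) ▸ hd.hasSum)
  funext k
  simpa using congrFun h0 k

/-- A variational inequality for the infinite-dimensional least squares problem, when the residual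
has finite support. -/
lemma convexFit_eq_of_forall_sum_nonpos {v : ℕ → ℝ} {N : ℕ} (hv : v ∈ convexL2)
    (hqv : ∀ k, N < k → q k = v k)
    (hvar : ∀ h ∈ convexL2, ∑ k ∈ Finset.Icc 0 N, (q k - v k) * (h k - v k) ≤ 0) :
    convexFit q = v := by
  -- The extra term ½‖h - v‖² yields uniqueness along with minimality, which identifies the chosen
  -- minimizer with v.
  have key : ∀ h ∈ convexL2, Summable (fun k => (h k - v k) ^ 2) ∧
      (1 / 2) * ∑' k, (q k - v k) ^ 2 + (1 / 2) * ∑' k, (h k - v k) ^ 2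
        ≤ (1 / 2) * ∑' k, (q k - h k) ^ 2 := by
    intro h hh
    have hout : ∀ k ∉ Finset.Icc 0 N, q k - v k = 0 := fun k hk => by
      rw [hqv k (by simpa using hk), sub_self]
    have s1 : Summable fun k => (h k - v k) ^ 2 := by
      refine Summable.of_nonneg_of_le (fun k => sq_nonneg _) (fun k => ?_)
        ((hh.1.mul_left 2).add (hv.1.mul_left 2))
      nlinarith [sq_nonneg (h k + v k)]
    have s2 : Summable fun k => (q k - v k) ^ 2 :=
      summable_of_ne_finset_zero (s := Finset.Icc 0 N) fun k hk => by simp [hout k hk]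
    have s3 : Summable fun k => (q k - v k) * (h k - v k) :=
      summable_of_ne_finset_zero (s := Finset.Icc 0 N) fun k hk => by simp [hout k hk]
    have e3 : ∑' k, (q k - v k) * (h k - v k)
        = ∑ k ∈ Finset.Icc 0 N, (q k - v k) * (h k - v k) :=
      tsum_eq_sum fun k hk => by simp [hout k hk]
    have e : ∑' k, (q k - h k) ^ 2 = ∑' k, (q k - v k) ^ 2
        - 2 * ∑' k, (q k - v k) * (h k - v k) + ∑' k, (h k - v k) ^ 2 := by
      rw [← tsum_mul_left, ← s2.tsum_sub (s3.mul_left 2), ← (s2.sub (s3.mul_left 2)).tsum_add s1]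
      exact tsum_congr fun k => by ring
    refine ⟨s1, ?_⟩
    rw [e, e3]
    linarith [hvar h hh]
  have hmin : IsMinimizer (fun p : ℕ → ℝ => (1 / 2) * ∑' j, (q j - p j) ^ 2) convexL2 v :=
    ⟨hv, fun h hh => by
      have := (key h hh).2
      have h0 : 0 ≤ ∑' k, (h k - v k) ^ 2 := tsum_nonneg fun k => sq_nonneg _
      simp only
      linarith⟩
  have hfit : IsMinimizer (fun p : ℕ → ℝ => (1 / 2) * ∑' j, (q j - p j) ^ 2) convexL2
      (convexFit q) := Classical.epsilon_spec ⟨v, hmin⟩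
  obtain ⟨s1, h1⟩ := key _ hfit.1
  have h2 := hfit.2 v hv
  simp only at h2
  have h3 := eq_zero_of_forall_tsum_le s1 (by linarith)
  funext k
  have := congrFun h3 k
  simp only [Pi.zero_apply] at this
  linarith

lemma exists_pos_le_lap (p : ℕ → ℝ) (N : ℕ) :
    ∃ ε : ℝ, 0 < ε ∧ ∀ k ≤ N, 0 < lap p k → ε ≤ lap p k := by
  have h : ∀ᶠ ε : ℝ in 𝓝[>] 0, ∀ k ∈ Finset.range (N + 1), 0 < lap p k → ε ≤ lap p k := by
    rw [Filter.eventually_all_finset]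
    intro k _
    by_cases hk : 0 < lap p k
    · filter_upwards [Ioo_mem_nhdsGT hk] with ε hε _ using hε.2.le
    · exact Eventually.of_forall fun _ h => absurd h hk
  obtain ⟨ε, h1, h2⟩ := (h.and self_mem_nhdsWithin).exists
  exact ⟨ε, h2, fun k hk => h1 k (by simpa [Nat.lt_succ_iff] using hk)⟩

lemma fit_zero_eq_zero_of_lt (w : ℕ → ℝ) {k : ℕ} (hk : S + 1 < k) : fit p S 0 w k = 0 :=
  toSeq_of_notMem _ (by simp; omega)

/-- The projection dominates the data at the right end point. -/
lemma le_fit_right_end (p w : ℕ → ℝ) (S : ℕ) : w (S + 1) ≤ fit p S 0 w (S + 1) := by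
  -- A unit bump at S + 1 is admissible: S + 1 is never the centre of a constrained second
  -- difference.
  have hconv : ConvexOffKnots p S 0 fun k => if k = S + 1 then 1 else 0 := fun k hk hkS _ => by
    simp only [lap, if_neg (show k ≠ S + 1 by omega), if_neg (show k - 1 ≠ S + 1 by omega)]
    split_ifs <;> norm_num
  have h := (fit_spec (p := p) (S := S) (Or.inl rfl) w).2.1 _ hconv
  simp only [mul_ite, mul_one, mul_zero] at h
  rw [Finset.sum_ite_eq' (Finset.Icc 0 (S + 1)), if_pos (by simp)] at h
  linarith

/-- If `q` is supported in `{0, …, S}` and close to `p`, the convex least squares fit of `q` is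
`p` plus the projection of `q - p` onto the cone `𝒞(𝒦)`. -/
lemma exists_convexFit_eq (hconv : IsConvexSeq p) (hsupp : ∀ k, p k ≠ 0 ↔ k ≤ S)
    (hpos : 0 < p S) :
    ∃ δ > 0, ∀ q : ℕ → ℝ, (∀ k, S < k → q k = 0) →
      (∀ k ≤ S + 1, |fit p S 0 (fun j => q j - p j) k| ≤ δ) →
      convexFit q = fun k => p k + fit p S 0 (fun j => q j - p j) k := by
  obtain ⟨ε, hε, hlap⟩ := exists_pos_le_lap p (S + 1)
  -- The coefficients 1, -2, 1 have total size 4, so such a perturbation lowers a second difference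
  -- by at most ε, the least positive one of p up to S + 1.
  refine ⟨ε / 4, by positivity, fun q hq hsmall => ?_⟩
  have hp0 : ∀ k, S < k → p k = 0 := fun k hk => by
    by_contra h
    exact absurd ((hsupp k).1 h) (not_le.2 hk)
  obtain ⟨r1, r2, r3⟩ := fit_spec (p := p) (S := S) (Or.inl rfl) fun j => q j - p j
  have rend := le_fit_right_end p (fun j => q j - p j) S
  have rout : ∀ k, S + 1 < k → fit p S 0 (fun j => q j - p j) k = 0 := fun k hk =>
    fit_zero_eq_zero_of_lt _ hk
  set r := fit p S 0 fun j => q j - p j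
  -- This leaves 0 ≤ r (S + 1), which is the second difference of p + r at S + 2.
  simp only [hq (S + 1) (by omega), hp0 (S + 1) (by omega), sub_zero] at rend
  have hlapadd : ∀ k, lap (fun j => p j + r j) k = lap p k + lap r k := fun k => by
    simp only [lap]; ring
  have hlapr : ∀ k, 1 ≤ k → -ε ≤ lap r k := by
    have hb : ∀ k, |r k| ≤ ε / 4 := fun k => by
      by_cases hk : k ≤ S + 1
      · exact hsmall k hk
      · rw [rout k (by omega), abs_zero]; positivity
    intro k _
    have h1 := abs_le.1 (hb (k + 1))
    have h2 := abs_le.1 (hb k)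
    have h3 := abs_le.1 (hb (k - 1))
    simp only [lap]
    linarith
  refine convexFit_eq_of_forall_sum_nonpos (N := S + 1) ⟨?_, ?_⟩ ?_ ?_
  · exact summable_of_ne_finset_zero (s := Finset.Icc 0 (S + 1)) fun k hk => by
      have hk : S + 1 < k := by simpa using hk
      simp [hp0 k (by omega), rout k hk]
  · intro k hk
    rw [hlapadd]
    by_cases hknot : 0 < lap p k ∧ k ≤ S + 1
    · linarith [hlap k hknot.2 hknot.1, hlapr k hk]
    · refine add_nonneg (hconv k hk) ?_
      rcases lt_trichotomy k (S + 1) with h | h | h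
      · exact r1 k hk (by omega) fun hmem => hknot ⟨hmem.2.2, h.le⟩
      -- The second difference of p at S + 1 equals p S, hence is positive, and the first case
      -- already covers it.
      · refine absurd ⟨?_, h.le⟩ hknot
        simp only [lap, h, hp0 (S + 1) (by omega), hp0 (S + 1 + 1) (by omega), Nat.add_sub_cancel]
        linarith
      · simp only [lap, rout k h, rout (k + 1) (by omega)]
        by_cases h' : k - 1 = S + 1
        · rw [h']; linarith
        · rw [rout (k - 1) (by omega)]; norm_num
  · intro k hk
    simp [hq k (by omega), hp0 k (by omega), rout k hk]
  · intro h hh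
    -- Subtracting p does no harm away from the knots, where its second difference is not positive.
    have hc : ConvexOffKnots p S 0 fun k => h k - p k := fun k hk hkS hknot => by
      have h1 : lap p k ≤ 0 := not_lt.1 fun hl => hknot ⟨hk, hkS, hl⟩
      have h2 := hh.2 k hk
      simp only [lap] at h1 h2 ⊢
      linarith
    have h1 := r2 _ hc
    have e : ∑ k ∈ Finset.Icc 0 (S + 1), (q k - (p k + r k)) * (h k - (p k + r k))
        = ∑ k ∈ Finset.Icc 0 (S + 1), (q k - p k - r k) * (h k - p k)
          - ∑ k ∈ Finset.Icc 0 (S + 1), (q k - p k - r k) * r k := by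
      rw [← Finset.sum_sub_distrib]
      exact Finset.sum_congr rfl fun k _ => by ring
    rw [e]
    linarith

end Fit

/-! ### Weak convergence of random vectors -/

section CramerWold

variable {ι Ω Ω' : Type*} [Fintype ι] [MeasurableSpace Ω] [MeasurableSpace Ω'] {P : Measure Ω}
  {Q : Measure Ω'}

lemma charFun_map_toLp {Y : Ω → ι → ℝ} (hY : AEMeasurable Y P) (t : EuclideanSpace ℝ ι) :
    charFun (P.map fun ω => WithLp.toLp 2 (Y ω)) t
      = charFun (P.map fun ω => ∑ k, t k * Y ω k) 1 := by
  have hY' : AEMeasurable (fun ω => WithLp.toLp 2 (Y ω)) P :=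
    (WithLp.measurable_toLp 2 (ι → ℝ)).comp_aemeasurable hY
  have hs : AEMeasurable (fun ω => ∑ k, t k * Y ω k) P :=
    Finset.aemeasurable_fun_sum _ fun k _ =>
      ((measurable_pi_apply k).comp_aemeasurable hY).const_mul _
  rw [charFun_apply, charFun_apply_real, integral_map hY' (by fun_prop),
    integral_map hs (by fun_prop)]
  simp [PiLp.inner_apply]

/-- The **Cramér–Wold device**. -/
lemma tendstoInDistribution_of_forall_sum_mul [IsProbabilityMeasure P]
    [IsProbabilityMeasure Q] {Y : ℕ → Ω → ι → ℝ} {Z : Ω' → ι → ℝ}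
    (hY : ∀ n, AEMeasurable (Y n) P) (hZ : AEMeasurable Z Q)
    (h : ∀ t : ι → ℝ, TendstoInDistribution (fun n ω => ∑ k, t k * Y n ω k) atTop
      (fun ω => ∑ k, t k * Z ω k) (fun _ => P) Q) :
    TendstoInDistribution Y atTop Z (fun _ => P) Q := by
  have hm : Measurable (WithLp.toLp 2 : (ι → ℝ) → EuclideanSpace ℝ ι) :=
    WithLp.measurable_toLp 2 (ι → ℝ)
  have key : TendstoInDistribution (fun n ω => (WithLp.toLp 2 (Y n ω) : EuclideanSpace ℝ ι)) atTop
      (fun ω => WithLp.toLp 2 (Z ω)) (fun _ => P) Q :=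
    { forall_aemeasurable := fun n => hm.comp_aemeasurable (hY n)
      aemeasurable_limit := hm.comp_aemeasurable hZ
      tendsto := by
        refine ProbabilityMeasure.tendsto_iff_tendsto_charFun.2 fun t => ?_
        have := ProbabilityMeasure.tendsto_iff_tendsto_charFun.1 (h t.ofLp).tendsto 1
        simp only [ProbabilityMeasure.coe_mk] at this ⊢
        rw [charFun_map_toLp hZ t]
        simpa only [charFun_map_toLp (hY _) t] using this }
  exact key.continuous_comp (g := WithLp.ofLp) (PiLp.continuous_ofLp 2 _)

end CramerWold

/-! ### Distribution functions -/

lemma cdf_natCast (p : ℕ → ℝ) (k : ℕ) : cdf p k = ∑ j ∈ Finset.range (k + 1), p j := by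
  rw [cdf]
  congr 2

lemma cdf_natCast_sub_one (p : ℕ → ℝ) (k : ℕ) : cdf p (k - 1) = ∑ j ∈ Finset.range k, p j := by
  rw [cdf]
  congr 2
  omega

section Noise

variable {Ω' : Type*} {U : ℝ → Ω' → ℝ} {p : ℕ → ℝ}

lemma noise_eq (p : ℕ → ℝ) (U : ℝ → Ω' → ℝ) (ω : Ω') (k : ℕ) :
    noise p U ω k
      = U (∑ j ∈ Finset.range (k + 1), p j) ω - U (∑ j ∈ Finset.range k, p j) ω := by
  rw [noise, cdf_natCast, cdf_natCast_sub_one]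

variable [MeasurableSpace Ω'] {Q : Measure Ω'}

lemma sum_range_noise (hU : IsBrownianBridge U Q) (ω : Ω') (s : ℕ) :
    ∑ k ∈ Finset.range s, noise p U ω k = U (cdf p (s - 1)) ω := by
  simp only [noise_eq]
  rw [Finset.sum_range_sub fun k => U (∑ j ∈ Finset.range k, p j) ω, cdf_natCast_sub_one]
  simp [hU.start]

lemma IsPmf.sum_range_mem_Icc (hp : IsPmf p) (k : ℕ) :
    ∑ j ∈ Finset.range k, p j ∈ Set.Icc (0 : ℝ) 1 :=
  ⟨Finset.sum_nonneg fun j _ => hp.1 j, sum_le_hasSum _ (fun j _ => hp.1 j) hp.2⟩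

lemma IsPmf.monotone_sum_range (hp : IsPmf p) :
    Monotone fun k => ∑ j ∈ Finset.range k, p j :=
  monotone_nat_of_le_succ fun k => by
    rw [Finset.sum_range_succ]
    linarith [hp.1 k]

/-- The increments `𝕎` form a Gaussian vector. -/
lemma hasGaussianLaw_noise (hp : IsPmf p) (hU : IsBrownianBridge U Q) (N : ℕ) :
    HasGaussianLaw (fun ω (k : Finset.Icc 0 N) => noise p U ω k) Q := by
  have h := hU.gaussian.hasGaussianLaw_increments (n := N + 1)
    (t := fun i => ⟨∑ j ∈ Finset.range i, p j, hp.sum_range_mem_Icc i⟩)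
  let L : (Fin (N + 1) → ℝ) →L[ℝ] (Finset.Icc 0 N → ℝ) :=
    ContinuousLinearMap.pi fun k =>
      ContinuousLinearMap.proj ⟨k, Nat.lt_succ_of_le (Finset.mem_Icc.1 k.2).2⟩
  have h2 := h.map_fun L
  have e : (fun ω (k : Finset.Icc 0 N) => noise p U ω k) = fun ω => L fun i : Fin (N + 1) =>
      U (∑ j ∈ Finset.range i.succ, p j) ω - U (∑ j ∈ Finset.range i.castSucc, p j) ω := by
    funext ω k
    exact noise_eq p U ω k
  rw [e]
  exact h2

lemma memLp_bridge (hU : IsBrownianBridge U Q) {t : ℝ} (ht : t ∈ Set.Icc (0 : ℝ) 1) :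
    MemLp (U t) 2 Q :=
  (hU.gaussian.hasGaussianLaw_eval ⟨t, ht⟩).memLp_two

lemma memLp_noise (hp : IsPmf p) (hU : IsBrownianBridge U Q) (k : ℕ) :
    MemLp (fun ω => noise p U ω k) 2 Q := by
  simp only [noise_eq]
  exact (memLp_bridge hU (hp.sum_range_mem_Icc _)).sub (memLp_bridge hU (hp.sum_range_mem_Icc _))

lemma integral_noise [IsProbabilityMeasure Q] (hp : IsPmf p) (hU : IsBrownianBridge U Q) (k : ℕ) :
    ∫ ω, noise p U ω k ∂Q = 0 := by
  simp only [noise_eq]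
  rw [integral_sub ((memLp_bridge hU (hp.sum_range_mem_Icc _)).integrable one_le_two)
    ((memLp_bridge hU (hp.sum_range_mem_Icc _)).integrable one_le_two),
    hU.mean _ (hp.sum_range_mem_Icc _), hU.mean _ (hp.sum_range_mem_Icc _), sub_zero]

/-- Bridge increments over consecutive intervals of lengths p k have the multinomial covariance;
monotonicity of the partial sums resolves each minimum. `covariance_indicator` has the same
right-hand side, which identifies the limit in the central limit theorem. -/
lemma covariance_noise [IsProbabilityMeasure Q] (hp : IsPmf p) (hU : IsBrownianBridge U Q) (k l : ℕ) :
    cov[fun ω => noise p U ω k, fun ω => noise p U ω l; Q]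
      = (if k = l then p k else 0) - p k * p l := by
  have hm := fun i => hp.sum_range_mem_Icc i
  have hL := fun i => memLp_bridge hU (hm i)
  have hmono := hp.monotone_sum_range
  simp only [noise_eq]
  rw [covariance_fun_sub_fun_sub (hL _) (hL _) (hL _) (hL _),
    hU.covariance _ (hm _) _ (hm _), hU.covariance _ (hm _) _ (hm _),
    hU.covariance _ (hm _) _ (hm _), hU.covariance _ (hm _) _ (hm _)]
  have hk := Finset.sum_range_succ p k
  have hl := Finset.sum_range_succ p l
  have h1 : ∀ {i j : ℕ}, i ≤ j → ∑ x ∈ Finset.range i, p x ≤ ∑ x ∈ Finset.range j, p x :=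
    fun h => hmono h
  rcases lt_trichotomy k l with h | h | h
  · rw [if_neg h.ne, min_eq_left (h1 (by omega)), min_eq_left (h1 (by omega)),
      min_eq_left (h1 (by omega)), min_eq_left (h1 (by omega)), hk, hl]
    ring
  · subst h
    rw [if_pos rfl, min_self, min_self, min_eq_right (h1 (by omega)),
      min_eq_left (h1 (by omega)), hk]
    ring
  · rw [if_neg h.ne', min_eq_right (h1 (by omega)), min_eq_right (h1 (by omega)),
      min_eq_right (h1 (by omega)), min_eq_right (h1 (by omega)), hk, hl]
    ring

end Noise

/-! ### The empirical probability mass function -/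

section Empirical

variable {Ω : Type*} [MeasurableSpace Ω] {P : Measure Ω} {X : ℕ → Ω → ℕ} {p : ℕ → ℝ}

lemma integral_indicator_eq (hX : ∀ i, Measurable (X i))
    (hlaw : ∀ i k, P.real {ω | X i ω = k} = p k) (i k : ℕ) :
    ∫ ω, (if X i ω = k then (1 : ℝ) else 0) ∂P = p k := by
  rw [← hlaw i k]
  refine (integral_congr_ae (ae_of_all _ fun ω => ?_)).trans
    (integral_indicator_one (hX i (measurableSet_singleton k)))
  simp [Set.indicator_apply]

variable [IsProbabilityMeasure P]

lemma identDistrib_of_forall_measureReal (hX : ∀ i, Measurable (X i))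
    (hlaw : ∀ i k, P.real {ω | X i ω = k} = p k) (i : ℕ) : IdentDistrib (X i) (X 0) P P where
  aemeasurable_fst := (hX i).aemeasurable
  aemeasurable_snd := (hX 0).aemeasurable
  map_eq := by
    refine Measure.ext_of_singleton fun k => ?_
    rw [Measure.map_apply (hX i) (measurableSet_singleton k),
      Measure.map_apply (hX 0) (measurableSet_singleton k)]
    have : P.real {ω | X i ω = k} = P.real {ω | X 0 ω = k} := by rw [hlaw, hlaw]
    exact (measureReal_eq_measureReal_iff).1 this

lemma memLp_indicator (hX : ∀ i, Measurable (X i)) (i k : ℕ) :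
    MemLp (fun ω => if X i ω = k then (1 : ℝ) else 0) 2 P := by
  refine MemLp.of_bound (C := 1) ?_ (ae_of_all _ fun ω => ?_)
  · exact ((measurable_of_countable fun m : ℕ => if m = k then (1 : ℝ) else 0).comp
      (hX i)).aestronglyMeasurable
  · split_ifs <;> simp

lemma covariance_indicator (hX : ∀ i, Measurable (X i))
    (hlaw : ∀ i k, P.real {ω | X i ω = k} = p k) (i k l : ℕ) :
    cov[fun ω => if X i ω = k then (1 : ℝ) else 0, fun ω => if X i ω = l then (1 : ℝ) else 0; P]
      = (if k = l then p k else 0) - p k * p l := by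
  rw [covariance_eq_sub (memLp_indicator hX i k) (memLp_indicator hX i l),
    integral_indicator_eq hX hlaw, integral_indicator_eq hX hlaw]
  congr 1
  split_ifs with h
  · subst h
    rw [← integral_indicator_eq hX hlaw i k]
    refine integral_congr_ae (ae_of_all _ fun ω => ?_)
    simp
  · rw [← integral_zero Ω ℝ]
    refine integral_congr_ae (ae_of_all _ fun ω => ?_)
    by_cases h1 : X i ω = k
    · simp [h1, h]
    · simp [h1]

/-- A function of the first `n` observations is measurable. -/
lemma measurable_comp_observations {E : Type*} [MeasurableSpace E] (hX : ∀ i, Measurable (X i))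
    (n : ℕ) (G : (ℕ → ℝ) → E) : Measurable fun ω => G (empPmf X n ω) := by
  have h : Measurable fun (ω : Ω) (i : Fin n) => X i ω := measurable_pi_iff.2 fun i => hX i
  have e : (fun ω => G (empPmf X n ω)) = (fun x : Fin n → ℕ => G fun j =>
      (1 / (n : ℝ)) * ∑ i : Fin n, if x i = j then 1 else 0) ∘ fun ω (i : Fin n) => X i ω := by
    funext ω
    simp only [Function.comp_apply]
    congr 1
    funext j
    rw [empPmf, Finset.sum_range fun i => if X i ω = j then (1 : ℝ) else 0]
  rw [e]
  -- Finitely many ℕ-valued observations take values in a countable discrete space, so every G is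
  -- allowed, including the least squares fit.
  exact (measurable_of_countable _).comp h

lemma ae_tendsto_empPmf (hX : ∀ i, Measurable (X i)) (hindep : iIndepFun X P)
    (hlaw : ∀ i k, P.real {ω | X i ω = k} = p k) :
    ∀ᵐ ω ∂P, ∀ k, Tendsto (fun n => empPmf X n ω k) atTop (𝓝 (p k)) := by
  rw [ae_all_iff]
  intro k
  have hm : Measurable fun m : ℕ => if m = k then (1 : ℝ) else 0 := measurable_of_countable _
  have h := strong_law_ae_real (μ := P) (fun i ω => if X i ω = k then (1 : ℝ) else 0)
    ((memLp_indicator hX 0 k).integrable one_le_two)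
    (fun i j hij => (hindep.indepFun hij).comp hm hm)
    (fun i => (identDistrib_of_forall_measureReal hX hlaw i).comp hm)
  rw [integral_indicator_eq hX hlaw] at h
  filter_upwards [h] with ω hω
  refine hω.congr fun n => ?_
  rw [empPmf, one_div, inv_mul_eq_div]

lemma ae_empPmf_eq_zero {S : ℕ} (hlaw : ∀ i k, P.real {ω | X i ω = k} = p k)
    (hp : ∀ k, S < k → p k = 0) :
    ∀ᵐ ω ∂P, ∀ n k, S < k → empPmf X n ω k = 0 := by
  have h : ∀ᵐ ω ∂P, ∀ i k, S < k → X i ω ≠ k := by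
    simp only [ae_all_iff]
    intro i k hk
    have h0 := hlaw i k
    rw [hp k hk, measureReal_eq_zero_iff] at h0
    rw [ae_iff]
    simpa using h0
  filter_upwards [h] with ω hω n k hk
  simp [empPmf, hω _ k hk]

variable {Ω' : Type*} [MeasurableSpace Ω'] {Q : Measure Ω'} [IsProbabilityMeasure Q]
  {U : ℝ → Ω' → ℝ}

/-- The rescaled empirical pmf converges in distribution to the increments of a Brownian bridge. -/
lemma tendstoInDistribution_empPmf (hp : IsPmf p) (hX : ∀ i, Measurable (X i))
    (hindep : iIndepFun X P) (hlaw : ∀ i k, P.real {ω | X i ω = k} = p k)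
    (hU : IsBrownianBridge U Q) (N : ℕ) :
    TendstoInDistribution
      (fun (n : ℕ) (ω : Ω) (k : Finset.Icc 0 N) => √(n : ℝ) * (empPmf X n ω k - p k)) atTop
      (fun ω k => noise p U ω k) (fun _ => P) Q := by
  have hW := hasGaussianLaw_noise hp hU N
  refine tendstoInDistribution_of_forall_sum_mul (fun n => ?_) hW.aemeasurable fun t => ?_
  · exact (measurable_comp_observations hX n
      fun q (k : Finset.Icc 0 N) => √(n : ℝ) * (q k - p k)).aemeasurable
  have hτ : Measurable fun m : ℕ => ∑ k : Finset.Icc 0 N, t k * if m = k then (1 : ℝ) else 0 :=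
    measurable_of_countable _
  let Y : ℕ → Ω → ℝ := fun i ω => ∑ k : Finset.Icc 0 N, t k * if X i ω = k then (1 : ℝ) else 0
  have hI : ∀ k : Finset.Icc 0 N,
      MemLp (fun ω => t k * if X 0 ω = k then (1 : ℝ) else 0) 2 P :=
    fun k => (memLp_indicator hX 0 k).const_mul (t k)
  have hJ : ∀ k : Finset.Icc 0 N, MemLp (fun ω => t k * noise p U ω k) 2 Q :=
    fun k => (memLp_noise hp hU k).const_mul (t k)
  have hY2 : MemLp (Y 0) 2 P := memLp_finsetSum _ fun k _ => hI k
  have hYmean : ∫ ω, Y 0 ω ∂P = ∑ k : Finset.Icc 0 N, t k * p k := by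
    rw [integral_finsetSum _ fun k _ => (hI k).integrable one_le_two]
    exact Finset.sum_congr rfl fun k _ => by
      rw [integral_const_mul, integral_indicator_eq hX hlaw]
  have hG : HasGaussianLaw (fun ω => ∑ k : Finset.Icc 0 N, t k * noise p U ω k) Q := by
    have := hW.map_fun (∑ k : Finset.Icc 0 N, t k • ContinuousLinearMap.proj (R := ℝ) k)
    simpa using this
  have hGmean : ∫ ω, (∑ k : Finset.Icc 0 N, t k * noise p U ω k) ∂Q = 0 := by
    rw [integral_finsetSum _ fun k _ => (hJ k).integrable one_le_two]
    exact Finset.sum_eq_zero fun k _ => by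
      rw [integral_const_mul, integral_noise hp hU, mul_zero]
  have hvar : Var[fun ω => ∑ k : Finset.Icc 0 N, t k * noise p U ω k; Q] = Var[Y 0; P] := by
    rw [← covariance_self hG.aemeasurable, ← covariance_self hY2.aemeasurable,
      covariance_fun_sum_fun_sum hJ hJ, covariance_fun_sum_fun_sum hI hI]
    refine Finset.sum_congr rfl fun k _ => Finset.sum_congr rfl fun l _ => ?_
    rw [covariance_const_mul_left, covariance_const_mul_right, covariance_const_mul_left,
      covariance_const_mul_right, covariance_noise hp hU, covariance_indicator hX hlaw]
  have hL : HasLaw (fun ω => ∑ k : Finset.Icc 0 N, t k * noise p U ω k)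
      (gaussianReal 0 Var[Y 0; P].toNNReal) Q :=
    ⟨hG.aemeasurable, by rw [hG.map_eq_gaussianReal, hGmean, hvar]⟩
  -- For a fixed t, the weighted empirical pmf is an average of i.i.d. variables, so the scalar
  -- central limit theorem applies.
  have hclt := tendstoInDistribution_inv_sqrt_mul_sum_sub hL hY2
    (hindep.comp (fun _ m => ∑ k : Finset.Icc 0 N, t k * if m = k then (1 : ℝ) else 0)
      fun _ => hτ)
    (fun i => (identDistrib_of_forall_measureReal hX hlaw i).comp hτ)
  refine hclt.congr (fun n => ae_of_all _ fun ω => ?_) (ae_of_all _ fun _ => rfl)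
  have e : ∑ i ∈ Finset.range n, Y i ω
      = ∑ k : Finset.Icc 0 N, t k * ∑ i ∈ Finset.range n, if X i ω = k then (1 : ℝ) else 0 := by
    rw [Finset.sum_comm]
    exact Finset.sum_congr rfl fun k _ => by rw [Finset.mul_sum]
  change (√(n : ℝ))⁻¹ * (∑ i ∈ Finset.range n, Y i ω - n * ∫ ω, Y 0 ω ∂P) = _
  rw [hYmean, e, Finset.mul_sum, ← Finset.sum_sub_distrib, Finset.mul_sum]
  refine Finset.sum_congr rfl fun k _ => ?_
  rcases Nat.eq_zero_or_pos n with rfl | hn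
  · simp
  · have hs : (0 : ℝ) < √(n : ℝ) := Real.sqrt_pos.2 (by exact_mod_cast hn)
    have hs2 : (n : ℝ) = √(n : ℝ) * √(n : ℝ) := (Real.mul_self_sqrt (Nat.cast_nonneg n)).symm
    have h1 : (√(n : ℝ)) * (1 / (n : ℝ)) = (√(n : ℝ))⁻¹ := by
      rw [hs2, Real.sqrt_mul_self hs.le]
      field_simp
    have h2 : (√(n : ℝ))⁻¹ * n = √(n : ℝ) := by
      nth_rewrite 2 [hs2]
      field_simp
    rw [empPmf, mul_sub, mul_sub, ← mul_assoc (√(n : ℝ)), h1, ← mul_assoc _ (n : ℝ)]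
    linear_combination -(t k * p k) * h2

end Empirical

/-! ### Convergence in distribution and in probability -/

section Convergence

variable {Ω Ω' E : Type*} [MeasurableSpace Ω] [MeasurableSpace Ω'] {P : Measure Ω}
  {Q : Measure Ω'} [IsProbabilityMeasure P] [IsProbabilityMeasure Q]

lemma tendstoInDistribution_of_ae_eventuallyEq [SeminormedAddCommGroup E]
    [SecondCountableTopology E] [MeasurableSpace E] [BorelSpace E] {Y V : ℕ → Ω → E} {Z : Ω' → E}
    (h : TendstoInDistribution V atTop Z (fun _ => P) Q) (hY : ∀ n, AEMeasurable (Y n) P)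
    (hYV : ∀ᵐ ω ∂P, ∀ᶠ n in atTop, Y n ω = V n ω) :
    TendstoInDistribution Y atTop Z (fun _ => P) Q := by
  refine tendstoInDistribution_of_tendstoInMeasure_sub Y Z h ?_ hY
  refine tendstoInMeasure_of_tendsto_ae
    (fun n => ((hY n).sub (h.forall_aemeasurable n)).aestronglyMeasurable) ?_
  filter_upwards [hYV] with ω hω
  refine tendsto_const_nhds.congr' ?_
  filter_upwards [hω] with n hn
  simp [hn]

/-- A sequence that converges in distribution converges to zero in probability if and only if its
limit is almost surely zero. -/
lemma tendstoInMeasure_zero_iff_ae_eq_zero {Y : ℕ → Ω → ℝ} {Z : Ω' → ℝ}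
    (h : TendstoInDistribution Y atTop Z (fun _ => P) Q) :
    TendstoInMeasure P Y atTop (fun _ => 0) ↔ Z =ᵐ[Q] fun _ => 0 := by
  constructor
  · intro h0
    have h1 := h0.tendstoInDistribution_of_aemeasurable h.forall_aemeasurable aemeasurable_const
    -- Limits in distribution are unique in law, so Z has the law of the constant 0.
    have h2 : IdentDistrib Z (fun _ : Ω => (0 : ℝ)) Q P :=
      ⟨h.aemeasurable_limit, aemeasurable_const, tendstoInDistribution_unique Y h h1⟩
    exact h2.symm.ae_snd (p := fun x => x = 0) (measurableSet_singleton 0)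
      (ae_of_all _ fun _ => rfl)
  · intro hZ
    rw [tendstoInMeasure_iff_norm]
    intro ε hε
    -- Portmanteau for {|x| ≥ ε}: the set and its frontier avoid 0, so both are null for the limit
    -- law.
    have hcl : IsClosed {x : ℝ | ε ≤ ‖x‖} := isClosed_le continuous_const continuous_norm
    have hset : ∀ x ∈ frontier {x : ℝ | ε ≤ ‖x‖}, x ≠ 0 := fun x hx h0 => by
      have : ε ≤ ‖x‖ := hcl.frontier_subset hx
      rw [h0, norm_zero] at this
      linarith
    have hnull : ∀ A : Set ℝ, MeasurableSet A → (∀ x ∈ A, x ≠ 0) → Q.map Z A = 0 := by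
      intro A hA hA0
      rw [Measure.map_apply_of_aemeasurable h.aemeasurable_limit hA]
      refine measure_mono_null (fun ω hω => ?_) (ae_iff.1 hZ)
      exact hA0 _ hω
    have := ProbabilityMeasure.tendsto_measure_of_null_frontier_of_tendsto' h.tendsto
      (E := {x : ℝ | ε ≤ ‖x‖}) (hnull _ isClosed_frontier.measurableSet hset)
    simp only [ProbabilityMeasure.coe_mk] at this
    rw [hnull _ hcl.measurableSet fun x hx h0 => by
      rw [Set.mem_ofPred_eq, h0, norm_zero] at hx; linarith] at this
    refine this.congr fun n => ?_
    rw [Measure.map_apply_of_aemeasurable (h.forall_aemeasurable n) hcl.measurableSet]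
    simp only [sub_zero]
    rfl

end Convergence

/-! ### Global and local projections -/

section TailGap

variable {p : ℕ → ℝ} {S s : ℕ}

lemma fit_const_mul {a : ℕ} {c : ℝ} (hc : 0 ≤ c) (w : ℕ → ℝ) (k : ℕ) :
    fit p S a (fun j => c * w j) k = c * fit p S a w k := by
  have h := proj_smul (isClosedConvexCone_knotCone p S a) hc fun j => w j
  have e : (c • fun j : Finset.Icc a (S + 1) => w j) = fun j : Finset.Icc a (S + 1) => c * w j :=
    rfl
  rw [e] at h
  simp only [fit, h, toSeq]
  split_ifs <;> simp

lemma continuous_tail {b : ℕ} (a : ℕ) : Continuous (tail (b := b) a) :=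
  continuous_pi fun _ => continuous_apply _

/-- The sum over `{s, …, S + 1}` of the residuals of the projection onto `𝒞(𝒦)`. -/
noncomputable def tailGap (p : ℕ → ℝ) (S s : ℕ) (v : Finset.Icc 0 (S + 1) → ℝ) : ℝ :=
  ∑ k, (tail s v k - tail s (proj (knotCone p S 0) v) k)

lemma tailGap_coe (p w : ℕ → ℝ) (S s : ℕ) :
    tailGap p S s (fun k => w k) = ∑ k ∈ Finset.Icc s (S + 1), (w k - fit p S 0 w k) := by
  rw [← Finset.sum_coe_sort (Finset.Icc s (S + 1)) fun k => w k - fit p S 0 w k, tailGap,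
    tail_eq_toSeq (proj _ _)]
  rfl

lemma continuous_tailGap (p : ℕ → ℝ) (S s : ℕ) : Continuous (tailGap p S s) := by
  have h := (continuous_tail (b := S + 1) s).comp
    (continuous_proj (isClosedConvexCone_knotCone p S 0))
  exact continuous_finsetSum _ fun k _ =>
    ((continuous_apply k).comp (continuous_tail s)).sub ((continuous_apply k).comp h)

variable {Ω' : Type*} {U : ℝ → Ω' → ℝ}

lemma localMin_eq_tail_gHat_iff (hs : s ∈ interiorKnots p S) (ω : Ω') :
    localMin p S s U ω = tail s (gHat p S U ω) ↔
      tailGap p S s (fun k => noise p U ω k) = 0 := by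
  rw [tailGap_coe]
  exact proj_eq_tail_iff hs (noise p U ω)

lemma GHat_eq (hs : s ∈ interiorKnots p S) (ω : Ω') :
    GHat p S U ω (s - 1) = ∑ k ∈ Finset.range s, fit p S 0 (noise p U ω) k := by
  have e : GHat p S U ω (s - 1) = ∑ k : Finset.Icc 0 (S + 1),
      if (k : ℕ) ≤ s - 1 then fit p S 0 (noise p U ω) k else 0 :=
    Finset.sum_congr rfl fun k _ => by rw [fit, toSeq_coe]; rfl
  rw [e, Finset.sum_coe_sort (Finset.Icc 0 (S + 1))
    fun k => if k ≤ s - 1 then fit p S 0 (noise p U ω) k else 0, ← Finset.sum_filter]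
  refine Finset.sum_congr ?_ fun _ _ => rfl
  -- A knot satisfies s ≥ 1, so the truncated difference s - 1 is the true one.
  obtain ⟨h1, h2, -⟩ := hs
  ext k
  simp only [Finset.mem_filter, Finset.mem_Icc, Finset.mem_range]
  omega

/-- Residuals have zero total, so the tail sum is minus the head sum, and the head sum of 𝕎
telescopes to 𝕌(F(s-1)). -/
lemma GHat_eq_iff [MeasurableSpace Ω'] {Q : Measure Ω'} (hU : IsBrownianBridge U Q)
    (hs : s ∈ interiorKnots p S) (ω : Ω') :
    GHat p S U ω (s - 1) = U (cdf p (s - 1)) ω ↔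
      tailGap p S s (fun k => noise p U ω k) = 0 := by
  have h := sum_range_sub_fit hs (noise p U ω)
  rw [Finset.sum_sub_distrib, sum_range_noise hU, ← GHat_eq hs, ← tailGap_coe] at h
  constructor <;> intro h' <;> linarith

end TailGap

/-! ### Limit distribution of the estimator -/

section Limit

variable {p : ℕ → ℝ} {S s : ℕ} {Ω : Type*} [MeasurableSpace Ω] {P : Measure Ω}
  [IsProbabilityMeasure P] {X : ℕ → Ω → ℕ} {Ω' : Type*} [MeasurableSpace Ω'] {Q : Measure Ω'}
  [IsProbabilityMeasure Q] {U : ℝ → Ω' → ℝ}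

/-- Almost surely, for all large `n`, the rescaled estimator is the projection of the rescaled
empirical pmf onto the cone `𝒞(𝒦)`. -/
lemma ae_eventually_lse_eq (hpmf : IsPmf p) (hconv : IsConvexSeq p)
    (hsupp : ∀ k, p k ≠ 0 ↔ k ≤ S) (hX : ∀ i, Measurable (X i)) (hindep : iIndepFun X P)
    (hlaw : ∀ i k, P.real {ω | X i ω = k} = p k) :
    ∀ᵐ ω ∂P, ∀ᶠ n : ℕ in atTop, ∀ k, √(n : ℝ) * (lse X n ω k - p k)
      = fit p S 0 (fun j => √(n : ℝ) * (empPmf X n ω j - p j)) k := by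
  have hp0 : ∀ k, S < k → p k = 0 := fun k hk => by
    by_contra h
    exact absurd ((hsupp k).1 h) (not_le.2 hk)
  obtain ⟨δ, hδ, hfit⟩ := exists_convexFit_eq hconv hsupp
    (lt_of_le_of_ne (hpmf.1 S) ((hsupp S).2 le_rfl).symm)
  filter_upwards [ae_tendsto_empPmf hX hindep hlaw, ae_empPmf_eq_zero hlaw hp0] with ω hω h0
  have hC := isClosedConvexCone_knotCone p S 0
  have hlim : Tendsto (fun n => proj (knotCone p S 0)
      fun k : Finset.Icc 0 (S + 1) => empPmf X n ω k - p k) atTop (𝓝 0) := by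
    have h1 : Tendsto (fun n (k : Finset.Icc 0 (S + 1)) => empPmf X n ω k - p k) atTop (𝓝 0) := by
      rw [tendsto_pi_nhds]
      intro k
      simpa using (hω k).sub_const (p k)
    have h2 := ((continuous_proj hC).tendsto 0).comp h1
    rwa [proj_zero hC] at h2
  filter_upwards [(tendsto_zero_iff_norm_tendsto_zero.1 hlim).eventually_le_const hδ] with n hn k
  have hsmall : ∀ k ≤ S + 1, |fit p S 0 (fun j => empPmf X n ω j - p j) k| ≤ δ := fun k hk => by
    rw [fit, toSeq, dif_pos (by simpa using hk), ← Real.norm_eq_abs]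
    exact (norm_le_pi_norm _ _).trans hn
  rw [lse, hfit _ (h0 n) hsmall, fit_const_mul (Real.sqrt_nonneg _), add_sub_cancel_left]

lemma tendstoInDistribution_lse_tail (hpmf : IsPmf p) (hconv : IsConvexSeq p)
    (hsupp : ∀ k, p k ≠ 0 ↔ k ≤ S) (hX : ∀ i, Measurable (X i)) (hindep : iIndepFun X P)
    (hlaw : ∀ i k, P.real {ω | X i ω = k} = p k) (hU : IsBrownianBridge U Q) (s : ℕ) :
    TendstoInDistribution
      (fun (n : ℕ) (ω : Ω) (k : Finset.Icc s (S + 1)) => √(n : ℝ) * (lse X n ω k - p k))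
      atTop (fun ω => tail s (gHat p S U ω)) (fun _ => P) Q := by
  have hW := tendstoInDistribution_empPmf hpmf hX hindep hlaw hU (S + 1)
  have h := hW.continuous_comp (g := fun v => tail s (proj (knotCone p S 0) v))
    ((continuous_tail s).comp (continuous_proj (isClosedConvexCone_knotCone p S 0)))
  refine tendstoInDistribution_of_ae_eventuallyEq h (fun n => ?_) ?_
  · exact (measurable_comp_observations hX n fun q (k : Finset.Icc s (S + 1)) =>
      √(n : ℝ) * (convexFit q k - p k)).aemeasurable
  · filter_upwards [ae_eventually_lse_eq hpmf hconv hsupp hX hindep hlaw] with ω hω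
    filter_upwards [hω] with n hn
    funext k
    rw [hn k]
    simp only [Function.comp_apply, tail_eq_toSeq]
    rfl

lemma tendstoInDistribution_cdf_lse_sub (hpmf : IsPmf p) (hconv : IsConvexSeq p)
    (hsupp : ∀ k, p k ≠ 0 ↔ k ≤ S) (hX : ∀ i, Measurable (X i)) (hindep : iIndepFun X P)
    (hlaw : ∀ i k, P.real {ω | X i ω = k} = p k) (hU : IsBrownianBridge U Q)
    (hs : s ∈ interiorKnots p S) :
    TendstoInDistribution
      (fun (n : ℕ) (ω : Ω) => √(n : ℝ) * (cdf (lse X n ω) (s - 1) - cdf (empPmf X n ω) (s - 1)))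
      atTop (fun ω => tailGap p S s fun k => noise p U ω k) (fun _ => P) Q := by
  have hW := tendstoInDistribution_empPmf hpmf hX hindep hlaw hU (S + 1)
  have h := hW.continuous_comp (continuous_tailGap p S s)
  refine tendstoInDistribution_of_ae_eventuallyEq h (fun n => ?_) ?_
  · exact (measurable_comp_observations hX n fun q =>
      √(n : ℝ) * (cdf (convexFit q) (s - 1) - cdf q (s - 1))).aemeasurable
  · filter_upwards [ae_eventually_lse_eq hpmf hconv hsupp hX hindep hlaw] with ω hω
    filter_upwards [hω] with n hn
    -- Passing from the head residuals, data minus fit, to the tail residuals flips the sign, which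
    -- matches the order estimator minus empirical.
    have e := sum_range_sub_fit hs fun j => √(n : ℝ) * (empPmf X n ω j - p j)
    refine Eq.trans ?_ (tailGap_coe p (fun j => √(n : ℝ) * (empPmf X n ω j - p j)) S s).symm
    rw [cdf_natCast_sub_one, cdf_natCast_sub_one, ← Finset.sum_sub_distrib,
      Finset.mul_sum, eq_comm, ← neg_eq_iff_eq_neg.2 e, ← Finset.sum_neg_distrib]
    refine Finset.sum_congr rfl fun k _ => ?_
    rw [← hn k]
    ring

/-- If the local and the restricted global projections have the same law, the tail residuals of the
global projection sum to zero almost surely, because they are never positive. -/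
lemma ae_tailGap_eq_zero (hpmf : IsPmf p) (hU : IsBrownianBridge U Q)
    (hs : s ∈ interiorKnots p S)
    (h : IdentDistrib (localMin p S s U) (fun ω => tail s (gHat p S U ω)) Q Q) :
    (fun ω => tailGap p S s fun k => noise p U ω k) =ᵐ[Q] fun _ => 0 := by
  have hsum := h.comp (u := fun g : Finset.Icc s (S + 1) → ℝ => ∑ k, g k) (by fun_prop)
  -- Local residuals sum to zero, so the coordinate sum of the local minimizer is a sum of
  -- increments of 𝕌, hence integrable; equality in law transfers integrability and mean to the
  -- other sum.
  have e1 : ∀ ω, ∑ k, localMin p S s U ω k = ∑ k ∈ Finset.Icc s (S + 1), noise p U ω k := by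
    intro ω
    have h0 := sum_sub_fit (p := p) (S := S) (Or.inr hs) (noise p U ω)
    rw [Finset.sum_sub_distrib, sub_eq_zero] at h0
    rw [h0, ← Finset.sum_coe_sort (Finset.Icc s (S + 1))]
    exact Finset.sum_congr rfl fun k _ => by rw [fit, toSeq_coe]; rfl
  have e2 : ∀ ω, (tailGap p S s fun k => noise p U ω k)
      = ∑ k, localMin p S s U ω k - ∑ k, tail s (gHat p S U ω) k := by
    intro ω
    rw [e1, tailGap, Finset.sum_sub_distrib, ← Finset.sum_coe_sort (Finset.Icc s (S + 1))]
    rfl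
  have i1 : Integrable (fun ω => ∑ k, localMin p S s U ω k) Q := by
    simp only [e1]
    exact integrable_finsetSum _ fun k _ => (memLp_noise hpmf hU k).integrable one_le_two
  have i2 : Integrable (fun ω => ∑ k, tail s (gHat p S U ω) k) Q := hsum.integrable_iff.1 i1
  have hint : ∫ ω, -(tailGap p S s fun k => noise p U ω k) ∂Q = 0 := by
    have e3 : ∫ ω, ∑ k, localMin p S s U ω k ∂Q = ∫ ω, ∑ k, tail s (gHat p S U ω) k ∂Q :=
      hsum.integral_eq
    rw [integral_neg]
    simp only [e2]
    rw [integral_sub i1 i2, e3, sub_self, neg_zero]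
  have hnn : 0 ≤ fun ω => -(tailGap p S s fun k => noise p U ω k) := fun ω => by
    simp only [Pi.zero_apply, tailGap_coe p (noise p U ω)]
    linarith [sum_tail_sub_fit_nonpos hs (noise p U ω)]
  have hi : Integrable (fun ω => -(tailGap p S s fun k => noise p U ω k)) Q := by
    simp only [e2]
    exact (i1.sub i2).neg
  filter_upwards [(integral_eq_zero_iff_of_nonneg hnn hi).1 hint] with ω hω
  simpa using hω

end Limit

end ConvexLSE

theorem theorem6
    -- the true pmf: convex, with finite support `{0, …, S}`
    (p₀ : ℕ → ℝ) (S : ℕ) (hpmf : ConvexLSE.IsPmf p₀) (hconv : ConvexLSE.IsConvexSeq p₀)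
    (hsupp : ∀ k, p₀ k ≠ 0 ↔ k ≤ S)
    -- i.i.d. observations with pmf `p₀`
    {Ω : Type*} [MeasurableSpace Ω] (P : Measure Ω) [IsProbabilityMeasure P]
    (X : ℕ → Ω → ℕ) (hX : ∀ i, Measurable (X i)) (hindep : iIndepFun X P)
    (hlaw : ∀ i k, P.real {ω | X i ω = k} = p₀ k)
    -- a standard Brownian bridge, possibly on another probability space
    {Ω' : Type*} [MeasurableSpace Ω'] (Q : Measure Ω') [IsProbabilityMeasure Q]
    (U : ℝ → Ω' → ℝ) (hU : ConvexLSE.IsBrownianBridge U Q)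
    -- an interior knot
    (s : ℕ) (hs : s ∈ ConvexLSE.interiorKnots p₀ S) :
    (∀ ω, ∃! g : Finset.Icc s (S + 1) → ℝ,
      ConvexLSE.IsMinimizer (ConvexLSE.crit S s (ConvexLSE.noise p₀ U ω))
        (ConvexLSE.knotCone p₀ S s) g) ∧
    (∀ ω, ConvexLSE.localMin p₀ S s U ω = ConvexLSE.tail s (ConvexLSE.gHat p₀ S U ω) ↔
      ConvexLSE.GHat p₀ S U ω (s - 1) = U (ConvexLSE.cdf p₀ (s - 1)) ω) ∧
    (TendstoInDistribution
        (fun (n : ℕ) (ω : Ω) (k : Finset.Icc s (S + 1)) =>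
          √(n : ℝ) * (ConvexLSE.lse X n ω k - p₀ k))
        atTop (ConvexLSE.localMin p₀ S s U) (fun _ => P) Q ↔
      TendstoInMeasure P
        (fun (n : ℕ) (ω : Ω) => √(n : ℝ) *
          (ConvexLSE.cdf (ConvexLSE.lse X n ω) (s - 1)
            - ConvexLSE.cdf (ConvexLSE.empPmf X n ω) (s - 1)))
        atTop (fun _ => 0)) := by
  have hlim := ConvexLSE.tendstoInDistribution_lse_tail hpmf hconv hsupp hX hindep hlaw hU s
  have hdiff := ConvexLSE.tendstoInDistribution_cdf_lse_sub hpmf hconv hsupp hX hindep hlaw hU hs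
  refine ⟨fun ω => ?_, fun ω => ?_, ?_⟩
  · have hC := ConvexLSE.isClosedConvexCone_knotCone p₀ S s
    have hg := ConvexLSE.isMinimizer_proj hC fun k => ConvexLSE.noise p₀ U ω k
    exact ⟨_, hg, fun g' hg' => ConvexLSE.IsMinimizer.eq hC hg' hg⟩
  · rw [ConvexLSE.localMin_eq_tail_gHat_iff hs, ConvexLSE.GHat_eq_iff hU hs]
  · rw [ConvexLSE.tendstoInMeasure_zero_iff_ae_eq_zero hdiff]
    constructor
    · intro h
      exact ConvexLSE.ae_tailGap_eq_zero hpmf hU hs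
        ⟨h.aemeasurable_limit, hlim.aemeasurable_limit, tendstoInDistribution_unique _ h hlim⟩
    · intro h
      refine hlim.congr (fun _ => Filter.EventuallyEq.rfl) ?_
      filter_upwards [h] with ω hω
      exact ((ConvexLSE.localMin_eq_tail_gHat_iff hs ω).2 hω).symm
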